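/- Let $n \geqslant 1$, let $I \in \mathbb{R}^{n\times n}$ be the identity matrix and $e \in \mathbb{R}^n$ the all-ones vector. Let $W \in \mathbb{R}^{n\times n}$ be (row-)stochastic, i.e. $W$ has nonnegative entries and $We = e$, and primitive, i.e. there is an integer $m \geqslant 1$ such that all entries of $W^m$ are strictly positive. Let $B \in \mathbb{R}^{n\times n}$ be such that all components of $Be$ are nonnegative and $Be \neq 0$. For real $t$ define $$P(t) = W(I - tB), \qquad R(t) = I - W + (I+tB)^{-1}(2W - I),$$ the latter whenever $I+tB$ is invertible. A matrix is called Schur stable if its spectral radius, the maximum of $|\lambda|$ over its complex eigenvalues $\lambda$, is strictly less than $1$. Then there exists $T > 0$ such that for all $0 < t < T$ the matrix $I + tB$ is invertible and both $P(t)$ and $R(t)$ are Schur stable. -/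

import Mathlib

open scoped Matrix

noncomputable section

/-- A complex square matrix is Schur stable if its spectral radius (the largest modulus of an
eigenvalue) is strictly less than one. -/
def IsSchurStable {n : ℕ} (M : Matrix (Fin n) (Fin n) ℂ) : Prop :=
  spectralRadius ℂ M < 1

/-- `P(t) = W (I - t B)`. -/
def opP {n : ℕ} (W B : Matrix (Fin n) (Fin n) ℝ) (t : ℝ) : Matrix (Fin n) (Fin n) ℝ :=
  W * (1 - t • B)

/-- `R(t) = I - W + (I + t B)⁻¹ (2 W - I)`, meaningful when `I + t B` is invertible. -/
def opR {n : ℕ} (W B : Matrix (Fin n) (Fin n) ℝ) (t : ℝ) : Matrix (Fin n) (Fin n) ℝ :=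
  1 - W + (1 + t • B)⁻¹ * ((2 : ℝ) • W - 1)

end

open Filter Topology

/-! Both matrices have the form `W + t G(t)` with `G(t) → G₀`, where `G₀` is `-WB` for `P` and
`-B(2W - 1)` for `R`. By primitivity, `1` is the only eigenvalue of `W` of modulus at least one, its
eigenvectors are constant, and some `p > 0` satisfies `pW = p`. To first order this eigenvalue moves
by `t (p G₀ e)/(p e)`; since `pW = p` and `(2W - 1)e = e`, in both cases the slope is `-(p B e)/(p
e) < 0`. Compactness replaces analytic perturbation theory: if stability fails along `t_k → 0`, unit
eigenvectors with `|μ_k| ≥ 1` subconverge to a constant vector, and pairing with `p` gives `μ_k = 1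
+ t_k z_k` with `z_k` tending to that slope, so eventually `|μ_k| < 1`. -/

section PerronFrobenius

variable {ι : Type*} [Fintype ι]

/-- An eigenvector of a positive stochastic matrix for an eigenvalue of modulus at least one is
constant. -/
lemma Matrix.eq_of_mulVec_eq_smul_of_pos {A : Matrix ι ι ℝ} (hpos : ∀ i j, 0 < A i j)
    (hA : A *ᵥ 1 = 1) {v : ι → ℂ} {μ : ℂ} (hμ : 1 ≤ ‖μ‖)
    (hv : A.map Complex.ofReal *ᵥ v = μ • v) (i j : ι) : v i = v j := by
  have : Nonempty ι := ⟨i⟩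
  obtain ⟨m, hm⟩ := Finite.exists_max fun i => ‖v i‖
  rcases eq_or_ne (v m) 0 with h0 | h0
  · have h (k : ι) : v k = 0 := norm_le_zero_iff.1 (by simpa [h0] using hm k)
    rw [h, h]
  have hμ0 : μ ≠ 0 := norm_pos_iff.1 (one_pos.trans_le hμ)
  have hrow : ∑ k, A m k = 1 := by
    simpa [Matrix.mulVec, dotProduct] using congrFun hA m
  -- Row `m` divided by `μ * v m` writes `1` as a convex combination, with positive weights, of
  -- points of the closed unit disc; so every point is `1`.
  have hsum : ∑ k, (A m k : ℂ) * (v k / (μ * v m)) = 1 := by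
    have h := congrFun hv m
    simp only [Matrix.mulVec, dotProduct, Matrix.map_apply, Pi.smul_apply, smul_eq_mul] at h
    simp only [← mul_div_assoc, ← Finset.sum_div]
    rw [h, div_self (mul_ne_zero hμ0 h0)]
  have hle (k : ι) : ‖v k / (μ * v m)‖ ≤ 1 := by
    rw [norm_div, norm_mul]
    have hm0 := norm_pos_iff.2 h0
    rw [div_le_one (by positivity)]
    nlinarith [hm k]
  have hre : ∑ k, A m k * (1 - (v k / (μ * v m)).re) = 0 := by
    have h := congrArg Complex.re hsum
    simp only [Complex.re_sum, Complex.re_ofReal_mul, Complex.one_re] at h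
    simp only [mul_sub, mul_one, Finset.sum_sub_distrib, hrow, h, sub_self]
  have hone (k : ι) : v k / (μ * v m) = 1 := by
    have h := (Finset.sum_eq_zero_iff_of_nonneg fun k _ => mul_nonneg (hpos m k).le
      (sub_nonneg.2 ((Complex.re_le_norm _).trans (hle k)))).1 hre k (Finset.mem_univ k)
    have hr : (v k / (μ * v m)).re = 1 := by
      linarith [(mul_eq_zero.1 h).resolve_left (hpos m k).ne']
    have hn := Complex.sq_norm_sub_sq_re (v k / (μ * v m))
    rw [hr] at hn
    have hi : (v k / (μ * v m)).im = 0 := by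
      have := hle k
      have := norm_nonneg (v k / (μ * v m))
      nlinarith [sq_nonneg (v k / (μ * v m)).im]
    exact Complex.ext hr hi
  have h (k : ι) : v k = μ * v m := (div_eq_one_iff_eq (mul_ne_zero hμ0 h0)).1 (hone k)
  rw [h i, h j]

variable [DecidableEq ι]

/-- The powers of a matrix act on an eigenvector by the powers of the eigenvalue. -/
lemma Matrix.pow_mulVec_eq_smul {R : Type*} [CommRing R] {A : Matrix ι ι R} {v : ι → R} {c : R}
    (h : A *ᵥ v = c • v) (k : ℕ) : (A ^ k) *ᵥ v = c ^ k • v := by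
  induction k with
  | zero => simp
  | succ k ih => rw [pow_succ, ← Matrix.mulVec_mulVec, h, Matrix.mulVec_smul, ih, smul_smul,
      pow_succ']

/-- The only eigenvalue of modulus at least one of a primitive stochastic matrix is `1`, and its
eigenvectors are constant. -/
lemma Matrix.IsPrimitive.eq_one_of_mulVec_eq_smul {W : Matrix ι ι ℝ} (hprim : W.IsPrimitive)
    (hW : W ∈ Matrix.rowStochastic ℝ ι) {v : ι → ℂ} (hv0 : v ≠ 0) {μ : ℂ} (hμ : 1 ≤ ‖μ‖)
    (hv : W.map Complex.ofReal *ᵥ v = μ • v) : μ = 1 ∧ ∃ c ≠ 0, v = fun _ => c := by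
  obtain ⟨m, -, hm⟩ := hprim.exists_pos_pow
  have hpow : (W ^ m).map Complex.ofReal *ᵥ v = μ ^ m • v := by
    have h := Matrix.pow_mulVec_eq_smul hv m
    rwa [← show (W ^ m).map Complex.ofReal = W.map Complex.ofReal ^ m from
      Matrix.map_pow W Complex.ofRealHom m] at h
  have hconst := Matrix.eq_of_mulVec_eq_smul_of_pos hm
    (Matrix.one_vecMul_of_mem_rowStochastic (pow_mem hW m))
    (by rw [norm_pow]; exact one_le_pow₀ hμ) hpow
  obtain ⟨i, hi⟩ := Function.ne_iff.1 hv0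
  have hc : v = fun _ => v i := funext fun j => hconst j i
  refine ⟨?_, v i, hi, hc⟩
  have h := congrFun hv i
  rw [hc] at h
  simp only [Matrix.mulVec, dotProduct, Matrix.map_apply, Pi.smul_apply, smul_eq_mul,
    ← Finset.sum_mul] at h
  have hs : ∑ j, (W i j : ℂ) = 1 := by
    exact_mod_cast congrArg Complex.ofReal (Matrix.sum_row_of_mem_rowStochastic hW i)
  rw [hs] at h
  exact (mul_right_cancel₀ hi h).symm

/-- A primitive stochastic matrix has a positive left fixed vector. -/
lemma Matrix.IsPrimitive.exists_pos_vecMul_eq {W : Matrix ι ι ℝ} [Nonempty ι]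
    (hprim : W.IsPrimitive) (hW : W ∈ Matrix.rowStochastic ℝ ι) :
    ∃ p : ι → ℝ, (∀ i, 0 < p i) ∧ p ᵥ* W = p := by
  have hdet : (W - 1).det = 0 := Matrix.exists_mulVec_eq_zero_iff.1
    ⟨1, one_ne_zero, by
      rw [Matrix.sub_mulVec, Matrix.one_vecMul_of_mem_rowStochastic hW, Matrix.one_mulVec, sub_self]⟩
  obtain ⟨u, hu0, hu⟩ := Matrix.exists_vecMul_eq_zero_iff.2 hdet
  rw [Matrix.vecMul_sub, Matrix.vecMul_one, sub_eq_zero] at hu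
  -- Both sides have the same total over `j` because rows sum to `1`, so equality holds throughout
  -- and `|u|` is itself fixed.
  have hle (j : ι) : |u j| ≤ ∑ i, |u i| * W i j := by
    conv_lhs => rw [← hu]
    refine (Finset.abs_sum_le_sum_abs _ _).trans_eq (Finset.sum_congr rfl fun i _ => ?_)
    rw [abs_mul, abs_of_nonneg (hprim.nonneg i j)]
  have htot : ∑ j, |u j| = ∑ j, ∑ i, |u i| * W i j := by
    rw [Finset.sum_comm]
    simp only [← Finset.mul_sum, Matrix.sum_row_of_mem_rowStochastic hW, mul_one]
  have hfix : (fun i => |u i|) ᵥ* W = fun i => |u i| := funext fun j =>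
    (((Finset.sum_eq_sum_iff_of_le fun j _ => hle j).1 htot) j (Finset.mem_univ j)).symm
  refine ⟨fun i => |u i|, fun j => ?_, hfix⟩
  obtain ⟨m, -, hm⟩ := hprim.exists_pos_pow
  have hfixm : (fun i => |u i|) ᵥ* (W ^ m) = fun i => |u i| := by
    clear hm
    induction m with
    | zero => simp
    | succ k ih => rw [pow_succ, ← Matrix.vecMul_vecMul, ih, hfix]
  obtain ⟨i, hi⟩ := Function.ne_iff.1 hu0
  refine lt_of_lt_of_eq ?_ (congrFun hfixm j)
  exact Finset.sum_pos' (fun k _ => mul_nonneg (abs_nonneg _) (hm k j).le)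
    ⟨i, Finset.mem_univ i, mul_pos (abs_pos.2 hi) (hm i j)⟩

end PerronFrobenius

/-! ### Compactness of eigenvectors -/

/-- A matrix of positive size that is not Schur stable has an eigenvector of norm one for an
eigenvalue of modulus at least one. -/
lemma exists_eigenvector_of_not_isSchurStable {n : ℕ} [NeZero n] {M : Matrix (Fin n) (Fin n) ℂ}
    (hM : ¬ IsSchurStable M) :
    ∃ (μ : ℂ) (v : Fin n → ℂ), 1 ≤ ‖μ‖ ∧ ‖v‖ = 1 ∧ M *ᵥ v = μ • v := by
  let := Matrix.linftyOpNormedRing (n := Fin n) (α := ℂ)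
  let := Matrix.linftyOpNormedAlgebra (n := Fin n) (R := ℂ) (α := ℂ)
  obtain ⟨μ, hμ, h1⟩ : ∃ μ ∈ spectrum ℂ M, 1 ≤ ‖μ‖₊ := by
    by_contra! h
    exact hM (spectrum.spectralRadius_lt_of_forall_lt M (r := 1) h)
  rw [← Matrix.spectrum_toLin', ← Module.End.hasEigenvalue_iff_mem_spectrum] at hμ
  obtain ⟨w, hw⟩ := hμ.exists_hasEigenvector
  have hw0 : ‖w‖ ≠ 0 := norm_ne_zero_iff.2 hw.2
  have hw1 : M *ᵥ w = μ • w := by simpa using hw.apply_eq_smul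
  refine ⟨μ, (‖w‖⁻¹ : ℂ) • w, h1, ?_, ?_⟩
  · rw [norm_smul, norm_inv, Complex.norm_real, norm_norm, inv_mul_cancel₀ hw0]
  · rw [Matrix.mulVec_smul, hw1, smul_comm]

/-- Convergence of real matrices and complex vectors implies convergence of their products. -/
lemma tendsto_map_ofReal_mulVec {α ι : Type*} [Fintype ι] {l : Filter α} {A : α → Matrix ι ι ℝ}
    {A₀ : Matrix ι ι ℝ} {v : α → ι → ℂ} {v₀ : ι → ℂ} (hA : Tendsto A l (𝓝 A₀))
    (hv : Tendsto v l (𝓝 v₀)) :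
    Tendsto (fun k => (A k).map Complex.ofReal *ᵥ v k) l (𝓝 (A₀.map Complex.ofReal *ᵥ v₀)) := by
  refine tendsto_pi_nhds.2 fun i => tendsto_finsetSum _ fun j _ => ?_
  exact ((Complex.continuous_ofReal.tendsto _).comp
    (tendsto_pi_nhds.1 (tendsto_pi_nhds.1 hA i) j)).mul (tendsto_pi_nhds.1 hv j)

/-- If the matrices `W + t G(t)` fail to be Schur stable for arbitrarily small `t > 0`, there are
eigenvectors for eigenvalues of modulus at least one that converge to a constant vector. -/
lemma exists_seq_eigenvector_tendsto_const {n : ℕ} [NeZero n] {W : Matrix (Fin n) (Fin n) ℝ}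
    (hW : W ∈ Matrix.rowStochastic ℝ (Fin n)) (hprim : W.IsPrimitive)
    {G : ℝ → Matrix (Fin n) (Fin n) ℝ} {G₀ : Matrix (Fin n) (Fin n) ℝ}
    (hG : Tendsto G (𝓝[>] 0) (𝓝 G₀))
    (hcon : ∃ᶠ t in 𝓝[>] (0 : ℝ), ¬ IsSchurStable ((W + t • G t).map Complex.ofReal)) :
    ∃ (s : ℕ → ℝ) (μ : ℕ → ℂ) (v : ℕ → Fin n → ℂ) (c : ℂ), c ≠ 0 ∧
      Tendsto s atTop (𝓝[>] 0) ∧ (∀ k, 1 ≤ ‖μ k‖) ∧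
      (∀ k, (W + s k • G (s k)).map Complex.ofReal *ᵥ v k = μ k • v k) ∧
      Tendsto v atTop (𝓝 fun _ => c) := by
  obtain ⟨s, hs, hbad⟩ := exists_seq_forall_of_frequently hcon
  choose μ v hμ hv heig using fun k => exists_eigenvector_of_not_isSchurStable (hbad k)
  obtain ⟨v₀, hv₀, φ, hφ, hvlim⟩ := (isCompact_sphere (0 : Fin n → ℂ) 1).tendsto_subseq
    (x := v) fun k => by simpa using hv k
  replace hv₀ : ‖v₀‖ = 1 := by simpa using hv₀
  have hs' : Tendsto (s ∘ φ) atTop (𝓝[>] 0) := hs.comp hφ.tendsto_atTop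
  have hs0 : Tendsto (s ∘ φ) atTop (𝓝 0) := hs'.mono_right nhdsWithin_le_nhds
  have hGs : Tendsto (fun k => G (s (φ k))) atTop (𝓝 G₀) := hG.comp hs'
  have hMv : Tendsto (fun k => μ (φ k) • v (φ k)) atTop (𝓝 (W.map Complex.ofReal *ᵥ v₀)) := by
    have hM : Tendsto (fun k => W + s (φ k) • G (s (φ k))) atTop (𝓝 W) := by
      simpa using tendsto_const_nhds.add (hs0.smul hGs)
    exact (tendsto_map_ofReal_mulVec hM hvlim).congr fun k => heig (φ k)
  have hv₀0 : v₀ ≠ 0 := by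
    rintro rfl
    simp at hv₀
  obtain ⟨i, hi⟩ := Function.ne_iff.1 hv₀0
  have hvi : Tendsto (fun k => v (φ k) i) atTop (𝓝 (v₀ i)) := tendsto_pi_nhds.1 hvlim i
  -- The eigenvalue is a quotient of coordinates of `μ • v` and `v`, so it converges without an a
  -- priori bound.
  obtain ⟨L, hL⟩ : ∃ L, Tendsto (fun k => μ (φ k)) atTop (𝓝 L) := by
    refine ⟨_, ((tendsto_pi_nhds.1 hMv i).div hvi hi).congr' ?_⟩
    filter_upwards [hvi.eventually_ne hi] with k hk
    exact mul_div_cancel_right₀ _ hk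
  obtain ⟨rfl, c, hc, rfl⟩ := hprim.eq_one_of_mulVec_eq_smul hW hv₀0
    (ge_of_tendsto' hL.norm fun k => hμ (φ k)) (tendsto_nhds_unique hMv (hL.smul hvlim))
  exact ⟨s ∘ φ, μ ∘ φ, v ∘ φ, c, hc, hs', fun k => hμ (φ k), fun k => heig (φ k), hvlim⟩

/-! ### First-order perturbation of the eigenvalue `1` -/

/-- If `z` tends to a limit with negative real part and `s` tends to `0` from the right, then
`1 + s z` eventually has modulus less than one. -/
lemma eventually_norm_one_add_mul_lt_one {α : Type*} {l : Filter α} {s : α → ℝ} {z : α → ℂ}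
    {z₀ : ℂ} (hs : Tendsto s l (𝓝[>] 0)) (hz : Tendsto z l (𝓝 z₀)) (hz₀ : z₀.re < 0) :
    ∀ᶠ k in l, ‖1 + s k * z k‖ < 1 := by
  have hd : Tendsto (fun k => 2 * (z k).re + s k * ‖z k‖ ^ 2) l (𝓝 (2 * z₀.re)) := by
    simpa using (((Complex.continuous_re.tendsto _).comp hz).const_mul 2).add
      ((hs.mono_right nhdsWithin_le_nhds).mul (hz.norm.pow 2))
  filter_upwards [hd.eventually_lt_const (by linarith : 2 * z₀.re < 0),
    hs.eventually self_mem_nhdsWithin] with k hk (hsk : 0 < s k)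
  have hnorm : ‖1 + s k * z k‖ ^ 2 = 1 + s k * (2 * (z k).re + s k * ‖z k‖ ^ 2) := by
    rw [Complex.sq_norm, Complex.sq_norm, Complex.normSq_apply, Complex.normSq_apply]
    simp
    ring
  nlinarith [mul_neg_of_pos_of_neg hsk hk, norm_nonneg (1 + s k * z k)]

/-- The shift of the eigenvalue `1` under a perturbation, in terms of a left fixed vector `q`. -/
lemma eigenvalue_add_smul_eq {ι K : Type*} [Fintype ι] [Field K] {A E : Matrix ι ι K}
    {q v : ι → K} {ε μ : K} (hq : q ᵥ* A = q) (hv : (A + ε • E) *ᵥ v = μ • v)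
    (hqv : q ⬝ᵥ v ≠ 0) : μ = 1 + ε * ((q ⬝ᵥ (E *ᵥ v)) / (q ⬝ᵥ v)) := by
  have h := congrArg (q ⬝ᵥ ·) hv
  simp only [Matrix.add_mulVec, Matrix.smul_mulVec, dotProduct_add, dotProduct_smul,
    smul_eq_mul] at h
  rw [Matrix.dotProduct_mulVec q A, hq] at h
  rw [mul_div_assoc', eq_comm, ← eq_sub_iff_add_eq', div_eq_iff hqv]
  linear_combination h

/-- First-order perturbation of a primitive stochastic matrix `W` with positive left fixed
vector `p`: the matrices `W + t G(t)` are Schur stable for small `t > 0` if the derivative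
`p (lim G) 1` of the Perron eigenvalue is negative. -/
lemma eventually_isSchurStable_add_smul {n : ℕ} [NeZero n] {W : Matrix (Fin n) (Fin n) ℝ}
    (hW : W ∈ Matrix.rowStochastic ℝ (Fin n)) (hprim : W.IsPrimitive) {p : Fin n → ℝ}
    (hp : ∀ i, 0 < p i) (hpW : p ᵥ* W = p) {G : ℝ → Matrix (Fin n) (Fin n) ℝ}
    {G₀ : Matrix (Fin n) (Fin n) ℝ} (hG : Tendsto G (𝓝[>] 0) (𝓝 G₀))
    (hneg : p ⬝ᵥ (G₀ *ᵥ 1) < 0) :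
    ∀ᶠ t in 𝓝[>] (0 : ℝ), IsSchurStable ((W + t • G t).map Complex.ofReal) := by
  by_contra hcon
  obtain ⟨s, μ, v, c, hc, hs', hμ, heig, hvlim⟩ :=
    exists_seq_eigenvector_tendsto_const hW hprim hG (not_eventually.1 hcon)
  have hGs : Tendsto (fun k => G (s k)) atTop (𝓝 G₀) := hG.comp hs'
  have hGv := tendsto_map_ofReal_mulVec hGs hvlim
  let q : Fin n → ℂ := fun i => p i
  have hqW : q ᵥ* W.map Complex.ofReal = q := by
    funext j
    have h := congrArg Complex.ofReal (congrFun hpW j)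
    simpa [Matrix.vecMul, dotProduct, q] using h
  have hdot : Continuous fun w : Fin n → ℂ => q ⬝ᵥ w := by
    unfold dotProduct
    fun_prop
  have hsum0 : 0 < ∑ i, p i := Finset.sum_pos (fun i _ => hp i) Finset.univ_nonempty
  have ha : Tendsto (fun k => q ⬝ᵥ v k) atTop (𝓝 ((∑ i, p i : ℝ) * c)) := by
    have h := (hdot.tendsto _).comp hvlim
    simpa [dotProduct, q, ← Finset.sum_mul, Function.comp_def] using h
  have ha0 : ((∑ i, p i : ℝ) * c : ℂ) ≠ 0 :=
    mul_ne_zero (Complex.ofReal_ne_zero.2 hsum0.ne') hc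
  have hb : Tendsto (fun k => q ⬝ᵥ ((G (s k)).map Complex.ofReal *ᵥ v k)) atTop
      (𝓝 ((p ⬝ᵥ (G₀ *ᵥ 1) : ℝ) * c)) := by
    have h := (hdot.tendsto _).comp hGv
    have he : q ⬝ᵥ (G₀.map Complex.ofReal *ᵥ fun _ => c) = (p ⬝ᵥ (G₀ *ᵥ 1) : ℝ) * c := by
      simp [dotProduct, Matrix.mulVec, q, ← Finset.sum_mul, ← mul_assoc]
    rwa [he] at h
  have hz := hb.div ha ha0
  -- The unknown constant `c` cancels, leaving a real limit.
  rw [mul_div_mul_right _ _ hc, ← Complex.ofReal_div] at hz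
  have hre : (((p ⬝ᵥ (G₀ *ᵥ 1)) / ∑ i, p i : ℝ) : ℂ).re < 0 := by
    rw [Complex.ofReal_re]
    exact div_neg_of_neg_of_pos hneg hsum0
  obtain ⟨k, hk, hk0⟩ := ((eventually_norm_one_add_mul_lt_one hs' hz hre).and
    (ha.eventually_ne ha0)).exists
  have hsplit : (W + s k • G (s k)).map Complex.ofReal =
      W.map Complex.ofReal + (s k : ℂ) • (G (s k)).map Complex.ofReal := by
    ext
    simp
  have hμz := eigenvalue_add_smul_eq hqW (hsplit ▸ heig k) hk0
  exact hk.not_ge ((hμ k).trans_eq (congrArg norm hμz))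

/-! ### Expansion of `R(t)` and conclusion -/

/-- `(1 + t B)⁻¹` tends to `1` as `t` tends to `0`. -/
lemma tendsto_inv_one_add_smul {ι : Type*} [Fintype ι] [DecidableEq ι] (B : Matrix ι ι ℝ) :
    Tendsto (fun t : ℝ => (1 + t • B)⁻¹) (𝓝 0) (𝓝 1) := by
  have hinv : ContinuousAt Inv.inv (1 + (0 : ℝ) • B) := continuousAt_matrix_inv _ (by
    simp [Ring.inverse_eq_inv'])
  have h := ContinuousAt.comp (f := fun t : ℝ => 1 + t • B) hinv
    (by fun_prop : Continuous fun t : ℝ => 1 + t • B).continuousAt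
  simpa [ContinuousAt, Function.comp_def] using h

/-- `1 + t B` is invertible for small `t`. -/
lemma eventually_isUnit_one_add_smul {ι : Type*} [Fintype ι] [DecidableEq ι] (B : Matrix ι ι ℝ) :
    ∀ᶠ t in 𝓝 (0 : ℝ), IsUnit (1 + t • B) := by
  have hc : Continuous fun t : ℝ => (1 + t • B).det :=
    (by fun_prop : Continuous fun t : ℝ => 1 + t • B).matrix_det
  filter_upwards [hc.continuousAt.eventually_ne (y := 0) (by simp)] with t ht
  exact (Matrix.isUnit_iff_isUnit_det _).2 (isUnit_iff_ne_zero.2 ht)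

/-- `R(t) = W - t B (1 + t B)⁻¹ (2 W - 1)` when `1 + t B` is invertible. -/
lemma opR_eq_add_smul {n : ℕ} (W B : Matrix (Fin n) (Fin n) ℝ) {t : ℝ} (h : IsUnit (1 + t • B)) :
    opR W B t = W + t • -(B * (1 + t • B)⁻¹ * ((2 : ℝ) • W - 1)) := by
  have hinv : (1 + t • B) * (1 + t • B)⁻¹ = 1 :=
    Matrix.mul_nonsing_inv _ ((Matrix.isUnit_iff_isUnit_det _).1 h)
  rw [add_mul, one_mul, Matrix.smul_mul] at hinv
  -- With `(1 + tB)⁻¹ = 1 - tB(1 + tB)⁻¹`, the remaining terms `1 - W + (2W - 1)` collapse to `W`.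
  rw [opR, smul_neg, ← Matrix.smul_mul, eq_sub_of_add_eq' hinv, eq_sub_of_add_eq hinv]
  simp only [sub_mul, one_mul, two_smul]
  abel

theorem mainTheorem5 {n : ℕ} (W B : Matrix (Fin n) (Fin n) ℝ)
    (hW_stoch : W ∈ Matrix.rowStochastic ℝ (Fin n)) (hW_prim : W.IsPrimitive)
    (hB_nonneg : ∀ i, 0 ≤ (B *ᵥ (1 : Fin n → ℝ)) i) (hB_ne : B *ᵥ (1 : Fin n → ℝ) ≠ 0) :
    ∃ T : ℝ, 0 < T ∧ ∀ t : ℝ, 0 < t → t < T →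
      IsSchurStable ((opP W B t).map Complex.ofReal) ∧
      IsUnit (1 + t • B) ∧ IsSchurStable ((opR W B t).map Complex.ofReal) := by
  obtain ⟨i, hi⟩ := Function.ne_iff.1 hB_ne
  have : NeZero n := ⟨fun h => (h ▸ i).elim0⟩
  obtain ⟨p, hp, hpW⟩ := hW_prim.exists_pos_vecMul_eq hW_stoch
  have hpB : 0 < p ⬝ᵥ (B *ᵥ 1) :=
    Finset.sum_pos' (fun j _ => mul_nonneg (hp j).le (hB_nonneg j))
      ⟨i, Finset.mem_univ i, mul_pos (hp i) ((hB_nonneg i).lt_of_ne' hi)⟩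
  have hone := Matrix.one_vecMul_of_mem_rowStochastic hW_stoch
  have hP : ∀ᶠ t in 𝓝[>] (0 : ℝ), IsSchurStable ((opP W B t).map Complex.ofReal) := by
    have hneg : p ⬝ᵥ (-(W * B) *ᵥ 1) < 0 := by
      rwa [Matrix.neg_mulVec, dotProduct_neg, ← Matrix.mulVec_mulVec, Matrix.dotProduct_mulVec p W,
        hpW, neg_lt_zero]
    have h := eventually_isSchurStable_add_smul hW_stoch hW_prim hp hpW
      (G := fun _ => -(W * B)) tendsto_const_nhds hneg
    refine h.mono fun t ht => ?_
    rwa [opP, mul_sub, mul_one, Matrix.mul_smul, sub_eq_add_neg, ← smul_neg]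
  have hU : ∀ᶠ t in 𝓝[>] (0 : ℝ), IsUnit (1 + t • B) :=
    (eventually_isUnit_one_add_smul B).filter_mono nhdsWithin_le_nhds
  have hR : ∀ᶠ t in 𝓝[>] (0 : ℝ), IsSchurStable ((opR W B t).map Complex.ofReal) := by
    have hG : Tendsto (fun t : ℝ => -(B * (1 + t • B)⁻¹ * ((2 : ℝ) • W - 1))) (𝓝[>] 0)
        (𝓝 (-(B * 1 * ((2 : ℝ) • W - 1)))) :=
      ((tendsto_const_nhds.mul ((tendsto_inv_one_add_smul B).mono_left nhdsWithin_le_nhds)).mul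
        tendsto_const_nhds).neg
    have hneg : p ⬝ᵥ (-(B * 1 * ((2 : ℝ) • W - 1)) *ᵥ 1) < 0 := by
      have h1 : ((2 : ℝ) • W - 1) *ᵥ (1 : Fin n → ℝ) = 1 := by
        rw [Matrix.sub_mulVec, Matrix.smul_mulVec, hone, Matrix.one_mulVec, two_smul,
          add_sub_cancel_right]
      rwa [mul_one, Matrix.neg_mulVec, dotProduct_neg, ← Matrix.mulVec_mulVec, h1, neg_lt_zero]
    filter_upwards [eventually_isSchurStable_add_smul hW_stoch hW_prim hp hpW hG hneg, hU]
      with t ht hu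
    rwa [opR_eq_add_smul W B hu]
  obtain ⟨T, hT, h⟩ := mem_nhdsGT_iff_exists_Ioo_subset.1 (hP.and (hU.and hR))
  exact ⟨T, hT, fun t h0 h1 => h ⟨h0, h1⟩⟩
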